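/- Let $\lambda\geq 2$ be a cardinal (finite or infinite), and let $P_\lambda$ be the $\lambda$-polycyclic monoid, i.e. the monoid with zero given by the presentation $$P_\lambda=\left\langle \{p_i\}_{i\in\lambda},\{p_i^{-1}\}_{i\in\lambda}\;\middle|\; p_ip_i^{-1}=1,\ p_ip_j^{-1}=0\text{ for } i\neq j\right\rangle .$$ A topological semigroup is a Hausdorff topological space together with a (jointly) continuous associative multiplication. A space is pseudocompact if every continuous real-valued function on it is bounded, and Tychonoff if it is completely regular and Hausdorff. Let $S$ be a topological semigroup such that $S\times S$ is a Tychonoff pseudocompact space. Then: 1. for every topology on $P_\lambda$ which makes it a topological semigroup, every continuous semigroup homomorphism $h\colon P_\lambda\to S$ is annihilating, i.e. there is $c\in S$ such that $h(s)=c$ for all $s\in P_\lambda$; 2. $S$ contains no copy of $P_\lambda$: no subsemigroup of $S$ is isomorphic to $P_\lambda$ as a semigroup. -/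

import Mathlib

universe u v

/-- The defining relations of the polycyclic monoid, on words over two copies of `ι`, with a zero
adjoined: the letter `Sum.inl i` stands for `p i` and `Sum.inr i` stands for `(p i)⁻¹`. -/
inductive PolycyclicRel (ι : Type u) :
    WithZero (FreeMonoid (ι ⊕ ι)) → WithZero (FreeMonoid (ι ⊕ ι)) → Prop
  | mul_inv_self (i : ι) : PolycyclicRel ι
      (((FreeMonoid.of (Sum.inl i) * FreeMonoid.of (Sum.inr i) : FreeMonoid (ι ⊕ ι))) :
        WithZero (FreeMonoid (ι ⊕ ι))) 1
  | mul_inv_of_ne (i j : ι) (h : i ≠ j) : PolycyclicRel ι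
      (((FreeMonoid.of (Sum.inl i) * FreeMonoid.of (Sum.inr j) : FreeMonoid (ι ⊕ ι))) :
        WithZero (FreeMonoid (ι ⊕ ι))) 0

/-- The polycyclic monoid on the set `ι` of generators: the monoid with zero presented by
`⟨p i, (p i)⁻¹ (i ∈ ι) ∣ p i * (p i)⁻¹ = 1, p i * (p j)⁻¹ = 0 for i ≠ j⟩`, that is, the quotient of
the free monoid with zero on the letters by the congruence which these relations generate. -/
def PolycyclicMonoid (ι : Type u) : Type u :=
  (conGen (PolycyclicRel ι)).Quotient

namespace PolycyclicMonoid

instance instMonoid (ι : Type u) : Monoid (PolycyclicMonoid ι) :=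
  inferInstanceAs (Monoid (conGen (PolycyclicRel ι)).Quotient)

end PolycyclicMonoid

/-- A homomorphism of semigroups is annihilating if it is constant. -/
def IsAnnihilating {S : Type u} {T : Type v} [Semigroup S] [Semigroup T] (h : S →ₙ* T) : Prop :=
  ∃ c : T, ∀ s : S, h s = c

/-- Every continuous real-valued function on `X` is bounded. -/
def IsPseudocompact (X : Type u) [TopologicalSpace X] : Prop :=
  ∀ f : X → ℝ, Continuous f → ∃ M : ℝ, ∀ x : X, |f x| ≤ M

/-!
The theorem rests on a cancellation principle: in a topological semigroup `S` with `S × S` Tychonoff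
and pseudocompact, if `a * b = e` and `e` is a two-sided identity for `a` and `b`, then `b * a = e`.

Given a continuous `φ : S → ℝ`, consider the functions `t ↦ φ (s * t)` for `s ∈ S`. By an argument
of Frolík, pseudocompactness of `S × S` makes this family depend on `s` continuously in the uniform
norm (`eventually_forall_abs_sub_le`), and then any sequence of such functions has two members which
are uniformly `ε`-close (`exists_lt_forall_abs_sub_le`). Apply this to `s = a ^ n` and substitute
`t = b ^ n * x`: for some `k ≥ 1`, `φ x` and `φ (a ^ k * x)` are `ε`-close whenever `e * x = x`. But
`x = e` and `x = b * a` give the same value `a ^ k * x = a ^ k`, so `φ e` and `φ (b * a)` are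
`2 * ε`-close. Continuous functions separate points, hence `b * a = e`.

If `h` is a homomorphism from the polycyclic monoid and `i ≠ j`, the principle gives
`h (p i)⁻¹ * h (p i) = h 1`; multiplying `h (p j)⁻¹` by it on the left yields
`h (p j)⁻¹ = h (p i)⁻¹ * h 0 = h 0`, so that `h 1 = h (p j) * h (p j)⁻¹ = h 0` and `h` is constant.
There is no injective such `h`, as `0 ≠ 1` in the polycyclic monoid: it acts on the functions
`List ι → ℤ`, with `0` acting as zero.
-/

open Topology Filter

/-! ### Pseudocompact products -/

section Pseudocompact

/-- In a completely regular pseudocompact space, no sequence of nonempty open sets is locally finite: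
otherwise a sum of bump functions of growing height would be an unbounded continuous function. -/
theorem IsPseudocompact.exists_forall_infinite {X : Type*} [TopologicalSpace X]
    [CompletelyRegularSpace X] (hX : IsPseudocompact X) (U : ℕ → Set X)
    (hU : ∀ n, IsOpen (U n)) (hne : ∀ n, (U n).Nonempty) :
    ∃ x, ∀ G ∈ 𝓝 x, {n | (U n ∩ G).Nonempty}.Infinite := by
  by_contra! hcon
  have hlf : LocallyFinite U := fun x => by
    obtain ⟨G, hG, hfin⟩ := hcon x
    exact ⟨G, hG, hfin⟩
  choose x hx using hne
  have hbump : ∀ n, ∃ g : X → ℝ, Continuous g ∧ (∀ y, 0 ≤ g y) ∧ g (x n) = n ∧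
      Function.support g ⊆ U n := by
    intro n
    obtain ⟨f, hf, h0, h1⟩ := CompletelyRegularSpace.completely_regular (x n) (U n)ᶜ
      (hU n).isClosed_compl (by simpa using hx n)
    refine ⟨fun y => n * (1 - (f y : ℝ)), by fun_prop, fun y => ?_, by simp [h0], fun y hy => ?_⟩
    · exact mul_nonneg n.cast_nonneg (sub_nonneg.2 (f y).2.2)
    · by_contra hyU
      exact hy (by simp [h1 hyU])
  choose g hgc hg0 hgx hgU using hbump
  have hlf' : LocallyFinite fun n => Function.support (g n) := hlf.subset hgU
  obtain ⟨M, hM⟩ := hX (fun y => ∑ᶠ n, g n y) (continuous_finsum hgc hlf')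
  obtain ⟨n, hn⟩ := exists_nat_gt M
  have hfin : (Function.support fun m => g m (x n)).Finite := hlf'.point_finite (x n)
  have hle : g n (x n) ≤ ∑ᶠ m, g m (x n) :=
    single_le_finsum n hfin fun m => hg0 m (x n)
  have := (le_abs_self _).trans (hM (x n))
  rw [hgx] at hle
  linarith

variable {X Y : Type*} [TopologicalSpace X] [TopologicalSpace Y] [CompletelyRegularSpace (X × Y)]

/-- On a pseudocompact product, the sections `f (x, ·)` of a continuous function vary continuously
in the uniform norm. -/
theorem eventually_forall_abs_sub_le (hXY : IsPseudocompact (X × Y)) {f : X × Y → ℝ}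
    (hf : Continuous f) (x₀ : X) {ε : ℝ} (hε : 0 < ε) :
    ∀ᶠ x in 𝓝 x₀, ∀ y, |f (x, y) - f (x₀, y)| ≤ ε := by
  by_contra hcon
  -- Every neighbourhood `U` of `x₀` contains an open `A` on which, over some open `B`, `f` stays
  -- away from its values over a smaller neighbourhood `V` of `x₀`.
  have step : ∀ U : {U : Set X // U ∈ 𝓝 x₀},
      ∃ (A : Set X) (B : Set Y) (V : {V : Set X // V ∈ 𝓝 x₀}),
      IsOpen A ∧ A.Nonempty ∧ A ⊆ U ∧ IsOpen B ∧ B.Nonempty ∧ V.1 ⊆ U ∧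
      ∀ a ∈ A, ∀ b ∈ B, ∀ v ∈ V.1, ε < |f (a, b) - f (v, b)| := by
    rintro ⟨U, hU⟩
    obtain ⟨O, hOU, hO, hxO⟩ := mem_nhds_iff.1 hU
    have : ∃ x ∈ O, ∃ y, ε < |f (x, y) - f (x₀, y)| := by
      by_contra! h
      exact hcon (Filter.mem_of_superset (hO.mem_nhds hxO) h)
    obtain ⟨x, hx, y, hxy⟩ := this
    have hopen : IsOpen {q : (X × Y) × X | ε < |f q.1 - f (q.2, q.1.2)|} :=
      isOpen_lt continuous_const (by fun_prop)
    obtain ⟨C, V, hC, hV, hxyC, hxV, hCV⟩ := isOpen_prod_iff.1 hopen (x, y) x₀ hxy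
    obtain ⟨A, B, hA, hB, hxA, hyB, hAB⟩ := isOpen_prod_iff.1 hC x y hxyC
    refine ⟨A ∩ O, B, ⟨V ∩ U, inter_mem (hV.mem_nhds hxV) hU⟩, hA.inter hO, ⟨x, hxA, hx⟩,
      fun a ha => hOU ha.2, hB, ⟨y, hyB⟩, Set.inter_subset_right, fun a ha b hb v hv => ?_⟩
    exact @hCV ((a, b), v) ⟨hAB ⟨ha.1, hb⟩, hv.1⟩
  choose A B V hA hAne hAU hB hBne hVU hfar using step
  let W : ℕ → {U : Set X // U ∈ 𝓝 x₀} := fun n => Nat.rec ⟨Set.univ, univ_mem⟩ (fun _ U => V U) n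
  have hW : Antitone fun n => (W n).1 := antitone_nat_of_succ_le fun n => hVU (W n)
  obtain ⟨⟨x, y⟩, hcl⟩ := hXY.exists_forall_infinite (fun n => A (W n) ×ˢ B (W n))
    (fun n => (hA _).prod (hB _)) (fun n => (hAne _).prod (hBne _))
  have hball : f ⁻¹' Metric.ball (f (x, y)) (ε / 2) ∈ 𝓝 (x, y) :=
    hf.continuousAt (Metric.ball_mem_nhds _ (half_pos hε))
  obtain ⟨G, hG, H, hH, hGH⟩ := mem_nhds_prod_iff.1 hball
  have hinf := hcl _ (prod_mem_nhds hG hH)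
  obtain ⟨n, ⟨p, q⟩, hpq, hpqG⟩ := hinf.nonempty
  obtain ⟨m, ⟨⟨p', q'⟩, hpq', hpqG'⟩, hnm⟩ := hinf.exists_gt n
  -- `(p, q)` and `(p', q)` both lie in `G ×ˢ H`, where `f` oscillates by less than `ε`.
  have hp' : p' ∈ (V (W n)).1 := hW (Nat.succ_le_of_lt hnm) (hAU _ hpq'.1)
  have hlt := hfar (W n) p hpq.1 q hpq.2 p' hp'
  have h1 : dist (f (p, q)) (f (x, y)) < ε / 2 := hGH hpqG
  have h2 : dist (f (p', q)) (f (x, y)) < ε / 2 := hGH (Set.mk_mem_prod hpqG'.1 hpqG.2)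
  have h3 := dist_triangle_right (f (p, q)) (f (p', q)) (f (x, y))
  rw [Real.dist_eq] at h3
  linarith

/-- On a pseudocompact product, any sequence of sections of a continuous function has two terms which
are uniformly close. -/
theorem exists_lt_forall_abs_sub_le (hXY : IsPseudocompact (X × Y)) {f : X × Y → ℝ}
    (hf : Continuous f) (u : ℕ → X) {ε : ℝ} (hε : 0 < ε) :
    ∃ n m, n < m ∧ ∀ y, |f (u n, y) - f (u m, y)| ≤ ε := by
  rcases isEmpty_or_nonempty Y with _ | _
  · exact ⟨0, 1, one_pos, fun y => isEmptyElim y⟩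
  have hnear := fun x => eventually_forall_abs_sub_le hXY hf x (show 0 < ε / 4 by linarith)
  choose O hO hOo huO using fun n => mem_nhds_iff.1 (hnear (u n))
  obtain ⟨⟨x, y₀⟩, hcl⟩ := hXY.exists_forall_infinite (fun n => O n ×ˢ Set.univ)
    (fun n => (hOo n).prod isOpen_univ) (fun n => ⟨⟨u n, Classical.arbitrary Y⟩, huO n, trivial⟩)
  have hinf := hcl _ (prod_mem_nhds (hnear x) univ_mem)
  obtain ⟨n, ⟨p, q⟩, hp, hpx⟩ := hinf.nonempty
  obtain ⟨m, ⟨⟨p', q'⟩, hp', hpx'⟩, hnm⟩ := hinf.exists_gt n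
  refine ⟨n, m, hnm, fun y => ?_⟩
  have h1 := abs_le.1 (hO n hp.1 y)
  have h2 := abs_le.1 (hpx.1 y)
  have h3 := abs_le.1 (hO m hp'.1 y)
  have h4 := abs_le.1 (hpx'.1 y)
  rw [abs_le]
  constructor <;> linarith

end Pseudocompact

/-! ### One-sided inverses in topological semigroups -/

/-- A one-sided inverse relative to an idempotent is two-sided; that is, `S` contains no copy of the
bicyclic monoid. -/
theorem mul_eq_of_mul_eq_of_isPseudocompact {S : Type*} [Semigroup S] [TopologicalSpace S]
    [ContinuousMul S] [T35Space (S × S)] (hS : IsPseudocompact (S × S)) {e a b : S}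
    (hab : a * b = e) (hea : e * a = a) (hae : a * e = a) (heb : e * b = b) : b * a = e := by
  have hee : e * e = e := by rw [← hab, ← mul_assoc, hab, hea, hab]
  -- `A^[n]` and `B^[n]` are left multiplication by `a ^ n` and `b ^ n`, and `A^[n] e` is `a ^ n`.
  let A : S → S := fun x => a * x
  let B : S → S := fun x => b * x
  have hA : ∀ n t, A^[n] e * t = A^[n] (e * t) := by
    intro n t
    induction n with
    | zero => rfl
    | succ n ih =>
      rw [Function.iterate_succ_apply', Function.iterate_succ_apply', ← ih]
      exact mul_assoc _ _ _
  have hB : ∀ n x, e * x = x → e * B^[n] x = B^[n] x := by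
    intro n x hx
    cases n with
    | zero => exact hx
    | succ n =>
      rw [Function.iterate_succ_apply']
      change e * (b * _) = b * _
      rw [← mul_assoc, heb]
  have hAB : ∀ n x, e * x = x → A^[n] (B^[n] x) = x := by
    intro n x hx
    induction n with
    | zero => rfl
    | succ n ih =>
      rw [Function.iterate_succ_apply, Function.iterate_succ_apply']
      change A^[n] (a * (b * B^[n] x)) = x
      rw [← mul_assoc, hab, hB n x hx, ih]
  have hclose : ∀ φ : S → ℝ, Continuous φ → ∀ ε > 0, |φ (b * a) - φ e| ≤ 2 * ε := by
    intro φ hφ ε hε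
    obtain ⟨n, m, hnm, h⟩ := exists_lt_forall_abs_sub_le hS (f := fun q => φ (q.1 * q.2))
      (by fun_prop) (fun n => A^[n] e) hε
    obtain ⟨k, rfl⟩ := Nat.exists_eq_add_of_lt hnm
    have key : ∀ x, e * x = x → |φ x - φ (A^[k] (a * x))| ≤ ε := by
      intro x hx
      have := h (B^[n] x)
      simp only [hA, hB n x hx, hAB n x hx] at this
      rwa [show n + k + 1 = k + 1 + n by omega, Function.iterate_add_apply, hAB n x hx] at this
    have h1 := key e hee
    have h2 := key (b * a) (by rw [← mul_assoc, heb])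
    rw [hae] at h1
    rw [← mul_assoc, hab, hea] at h2
    rw [abs_le] at *
    constructor <;> linarith
  by_contra hne
  obtain ⟨f, hf, h0, h1⟩ := CompletelyRegularSpace.completely_regular (b * a, b * a) {(e, e)}
    isClosed_singleton (by simpa using hne)
  have := hclose (fun x => f (x, x)) (by fun_prop) (1 / 4) (by norm_num)
  rw [h0, h1 rfl] at this
  norm_num at this

/-! ### The polycyclic monoid -/

namespace PolycyclicMonoid

variable (ι : Type*)

/-- The quotient map from words with zero to the polycyclic monoid. -/
def mk : WithZero (FreeMonoid (ι ⊕ ι)) →* PolycyclicMonoid ι :=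
  (conGen (PolycyclicRel ι)).mk'

variable {ι}

/-- The generator `p i`. -/
def p (i : ι) : PolycyclicMonoid ι := mk ι (FreeMonoid.of (Sum.inl i) : FreeMonoid (ι ⊕ ι))

/-- The generator `(p i)⁻¹`. -/
def pInv (i : ι) : PolycyclicMonoid ι := mk ι (FreeMonoid.of (Sum.inr i) : FreeMonoid (ι ⊕ ι))

theorem p_mul_pInv_self (i : ι) : p i * pInv i = 1 := by
  rw [p, pInv, ← map_mul, ← WithZero.coe_mul, ← map_one (mk ι)]
  exact (Con.eq _).2 (ConGen.Rel.of _ _ (.mul_inv_self i))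

theorem p_mul_pInv_of_ne {i j : ι} (h : i ≠ j) : p i * pInv j = mk ι 0 := by
  rw [p, pInv, ← map_mul, ← WithZero.coe_mul]
  exact (Con.eq _).2 (ConGen.Rel.of _ _ (.mul_inv_of_ne i j h))

theorem mk_zero_mul (s : PolycyclicMonoid ι) : mk ι 0 * s = mk ι 0 := by
  obtain ⟨w, rfl⟩ := Con.mk'_surjective s
  exact (map_mul (mk ι) 0 w).symm.trans (by rw [zero_mul])

theorem mul_mk_zero (s : PolycyclicMonoid ι) : s * mk ι 0 = mk ι 0 := by
  obtain ⟨w, rfl⟩ := Con.mk'_surjective s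
  exact (map_mul (mk ι) w 0).symm.trans (by rw [mul_zero])

open Classical in
/-- The action of the letters on functions `List ι → ℤ`: `p i` pulls a function back along `List.cons i`,
and `(p i)⁻¹` pushes it forward, extending by zero off the lists with head `i`. -/
noncomputable def letterEnd : ι ⊕ ι → Module.End ℤ (List ι → ℤ)
  | .inl i => LinearMap.funLeft ℤ ℤ (List.cons i)
  | .inr i =>
    { toFun := fun f l => if l.head? = some i then f l.tail else 0
      map_add' := fun f g => by ext l; simp only [Pi.add_apply]; split_ifs <;> simp
      map_smul' := fun c f => by ext l; simp }

theorem mk_zero_ne_one : mk ι 0 ≠ 1 := by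
  let F : WithZero (FreeMonoid (ι ⊕ ι)) →*₀ Module.End ℤ (List ι → ℤ) :=
    WithZero.lift' (FreeMonoid.lift letterEnd)
  have hF : conGen (PolycyclicRel ι) ≤ Con.ker F.toMonoidHom := by
    refine Con.conGen_le.2 fun x y hxy => ?_
    rw [Con.ker_rel]
    change F x = F y
    cases hxy with
    | mul_inv_self i =>
      rw [map_one, WithZero.lift'_coe, map_mul, FreeMonoid.lift_eval_of, FreeMonoid.lift_eval_of]
      ext f l
      simp [letterEnd, LinearMap.funLeft_apply]
    | mul_inv_of_ne i j h =>
      rw [map_zero, WithZero.lift'_coe, map_mul, FreeMonoid.lift_eval_of, FreeMonoid.lift_eval_of]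
      ext f l
      simp [letterEnd, LinearMap.funLeft_apply, h]
  intro h
  have h01 : F 0 = F 1 := hF ((Con.eq _).1 (h.trans (map_one (mk ι)).symm))
  rw [map_zero, map_one] at h01
  exact zero_ne_one h01

/-- Every homomorphism to a semigroup with Tychonoff pseudocompact square is constant, whether or not
it is continuous. -/
theorem isAnnihilating_of_isPseudocompact [Nontrivial ι] {S : Type*} [Semigroup S]
    [TopologicalSpace S] [ContinuousMul S] [T35Space (S × S)] (hS : IsPseudocompact (S × S))
    (h : PolycyclicMonoid ι →ₙ* S) : IsAnnihilating h := by
  obtain ⟨i, j, hij⟩ := exists_pair_ne ι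
  have hinv : h (pInv i) * h (p i) = h 1 := by
    apply mul_eq_of_mul_eq_of_isPseudocompact hS <;> simp only [← map_mul]
    · rw [p_mul_pInv_self]
    · rw [one_mul]
    · rw [mul_one]
    · rw [one_mul]
  have hj : h (pInv j) = h (mk ι 0) := by
    rw [← one_mul (pInv j), map_mul, ← hinv, ← map_mul, ← map_mul, mul_assoc,
      p_mul_pInv_of_ne hij, mul_mk_zero]
  have h10 : h 1 = h (mk ι 0) := by
    rw [← p_mul_pInv_self j, map_mul, hj, ← map_mul, mul_mk_zero]
  refine ⟨h (mk ι 0), fun s => ?_⟩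
  rw [← one_mul s, map_mul, h10, ← map_mul, mk_zero_mul]

end PolycyclicMonoid

/-- `P_λ` is `PolycyclicMonoid ι` with `λ = #ι`. A topological semigroup is a Hausdorff space with a
jointly continuous associative multiplication. A copy of `P_λ` in `S` is a subsemigroup of `S` that
is isomorphic to `P_λ` as a semigroup. -/
theorem proposition4p2 {ι : Type u} (hι : 2 ≤ Cardinal.mk ι)
    {S : Type v} [Semigroup S] [TopologicalSpace S] [T2Space S] [ContinuousMul S]
    (htych : T35Space (S × S)) (hpseudo : IsPseudocompact (S × S)) :
    (∀ [TopologicalSpace (PolycyclicMonoid ι)] [T2Space (PolycyclicMonoid ι)]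
        [ContinuousMul (PolycyclicMonoid ι)] (h : PolycyclicMonoid ι →ₙ* S),
        Continuous h → IsAnnihilating h) ∧
      ¬ ∃ T : Subsemigroup S, Nonempty (PolycyclicMonoid ι ≃* T) := by
  have : Nontrivial ι := by rwa [← Cardinal.one_lt_iff_nontrivial, ← Cardinal.two_le_iff_one_lt]
  have hconst : ∀ h : PolycyclicMonoid ι →ₙ* S, IsAnnihilating h :=
    PolycyclicMonoid.isAnnihilating_of_isPseudocompact hpseudo
  refine ⟨fun h _ => hconst h, ?_⟩
  rintro ⟨T, ⟨g⟩⟩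
  obtain ⟨c, hc⟩ := hconst ((MulMemClass.subtype T).comp (g : PolycyclicMonoid ι →ₙ* T))
  refine PolycyclicMonoid.mk_zero_ne_one (ι := ι) (g.injective (Subtype.ext ?_))
  exact (hc _).trans (hc 1).symm
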